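/- Let $F$ be a field, let $R$ be an associative unital $F$-algebra and let $X$ be a nonempty set. For every $x\in X$ let $\sigma_x$ be an automorphism of the $F$-algebra $R$ and let $\delta_x\colon R\to R$ be a $\sigma_x$-derivation, that is, an additive map with $\delta_x(ab)=\delta_x(a)b+\sigma_x(a)\delta_x(b)$ for all $a,b\in R$. Put $\mathscr{G}=\{\sigma_x\}_{x\in X}$ and $\mathscr{D}=\{\delta_x\}_{x\in X}$. Let $S=R[X;\mathscr{G},\mathscr{D}]$ be the free skew extension of $R$, i.e. a ring that contains $R$ as a subring and contains the elements $x\in X$, that is a free left $R$-module with basis the set of words of the free monoid $\langle X\rangle$, and in which $xr=\sigma_x(r)x+\delta_x(r)$ for all $x\in X$, $r\in R$. Let $P(R)$ be the prime radical of $R$ (the intersection of all prime ideals). For $q\in F$ put $(n!)_q=\prod_{i=1}^n(1+q+\cdots+q^{i-1})$. Suppose that 1. $P(R)$ is nilpotent, with index of nilpotency equal to $n$ (the least $n$ with $P(R)^n=0$); 2. $R/P(R)$ is left Goldie, i.e. it contains no infinite direct sum of nonzero left ideals and satisfies the ascending chain condition on left annihilators; 3. for every $x\in X$ there is a nonzero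 $q_x\in F$ with $\delta_x\sigma_x=q_x\sigma_x\delta_x$ and $(n!)_{q_x}\neq 0$ in $F$. Then the Jacobson radical $J(R[X;\mathscr{G},\mathscr{D}])$ is nilpotent. -/

import Mathlib

/-- `δ` is a `σ`-derivation of the ring `R`: an additive map satisfying the `σ`-Leibniz rule. -/
def IsSkewDerivation {R : Type*} [Ring R] (σ : R →+* R) (δ : R →+ R) : Prop :=
  ∀ a b : R, δ (a * b) = δ a * b + σ a * δ b

/-- The ring `S`, with the inclusion `ι : R → S` and the elements `v x` (`x ∈ X`), is a free skew
extension `R[X; σ, δ]`: `R` is a subring of `S`, the words in the `v x` form a basis of `S` as a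
left `R`-module (every element of `S` is in exactly one way a finite sum `∑ r_w w` over words
`w ∈ ⟨X⟩`), and `x r = σ_x(r) x + δ_x(r)`. -/
structure IsFreeSkewExtension {R X S : Type*} [Ring R] [Ring S] (σ : X → R →+* R)
    (δ : X → R →+ R) (ι : R →+* S) (v : X → S) : Prop where
  injective : Function.Injective ι
  basis : Function.Bijective (fun f : FreeMonoid X →₀ R =>
    f.sum (fun w r => ι r * FreeMonoid.lift v w))
  commutation : ∀ (x : X) (r : R), v x * ι r = ι (σ x r) * v x + ι (δ x r)

/-- A prime (two-sided) ideal of a possibly noncommutative ring: a proper two-sided ideal `P` such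
that `a R b ⊆ P` implies `a ∈ P` or `b ∈ P`. -/
structure IsTwoSidedPrime {R : Type*} [Ring R] (P : Ideal R) : Prop where
  isTwoSided : P.IsTwoSided
  ne_top : P ≠ ⊤
  mem_or_mem : ∀ a b : R, (∀ r : R, a * r * b ∈ P) → a ∈ P ∨ b ∈ P

/-- The prime radical: the intersection of all prime ideals. -/
def primeRadical (R : Type*) [Ring R] : Ideal R :=
  sInf {P : Ideal R | IsTwoSidedPrime P}

instance primeRadical_isTwoSided (R : Type*) [Ring R] : (primeRadical R).IsTwoSided where
  mul_mem_of_left := by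
    intro a b ha
    simp only [primeRadical, Submodule.mem_sInf, Set.mem_ofPred_eq] at ha ⊢
    intro P hP
    have := hP.isTwoSided
    exact Ideal.mul_mem_right b P (ha P hP)

/-- The left annihilator `{r | r A = 0}` of a subset `A` of a ring. -/
def leftAnnihilator {R : Type*} [Ring R] (A : Set R) : Ideal R where
  carrier := {r | ∀ a ∈ A, r * a = 0}
  add_mem' := by
    intro r s hr hs a ha
    rw [add_mul, hr a ha, hs a ha, add_zero]
  zero_mem' := fun a _ => zero_mul a
  smul_mem' := by
    intro c r hr a ha
    rw [smul_eq_mul, mul_assoc, hr a ha, mul_zero]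

/-- A left Goldie ring: there is no infinite direct sum of nonzero left ideals, and every ascending
chain of left annihilators becomes stationary. (`Ideal R` is the type of left ideals.) -/
structure IsLeftGoldie (R : Type*) [Ring R] : Prop where
  no_infinite_direct_sum : ¬ ∃ L : ℕ → Ideal R, (∀ i, L i ≠ ⊥) ∧ iSupIndep L
  acc_leftAnnihilator : ∀ A : ℕ → Set R, Monotone (fun i => leftAnnihilator (A i)) →
    ∃ N, ∀ m, N ≤ m → leftAnnihilator (A m) = leftAnnihilator (A N)

/-- The `q`-factorial `(n!)_q = ∏_{i=1}^n (1 + q + ⋯ + q^{i-1})`. -/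
def qFactorial {F : Type*} [Field F] (q : F) (n : ℕ) : F :=
  ∏ i ∈ Finset.Icc 1 n, ∑ j ∈ Finset.range i, q ^ j

/-- The additive endomorphism `∑ r_w w ↦ ∑ (σ_x(r_w) x w + δ_x(r_w) w)`, which is the left
multiplication by `x` in the free skew extension. -/
noncomputable def skewVarEnd {R X : Type*} [Ring R] (σ : X → R →+* R) (δ : X → R →+ R) (x : X) :
    AddMonoid.End (FreeMonoid X →₀ R) :=
  Finsupp.liftAddHom (fun w =>
    (Finsupp.singleAddHom (FreeMonoid.of x * w)).comp (σ x).toAddMonoidHom +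
      (Finsupp.singleAddHom w).comp (δ x))

/-- Free skew extensions exist. -/
theorem exists_isFreeSkewExtension.{u, w} {R : Type u} {X : Type w} [Ring R] (σ : X → R →+* R)
    (δ : X → R →+ R) (hδ : ∀ x, IsSkewDerivation (σ x) (δ x)) :
    ∃ (S : Type (max u w)) (_ : Ring S) (ι : R →+* S) (v : X → S),
      IsFreeSkewExtension σ δ ι v := by
  let E := AddMonoid.End (FreeMonoid X →₀ R)
  let ιE : R →+* E := Module.toAddMonoidEnd R (FreeMonoid X →₀ R)
  let vE : X → E := skewVarEnd σ δ
  have hι : ∀ (r : R) (w : FreeMonoid X) (s : R),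
      ιE r (Finsupp.single w s) = Finsupp.single w (r * s) := by
    intro r w s
    exact Finsupp.smul_single r w s
  have hv : ∀ (x : X) (w : FreeMonoid X) (s : R), vE x (Finsupp.single w s) =
      Finsupp.single (FreeMonoid.of x * w) (σ x s) + Finsupp.single w (δ x s) := by
    intro x w s
    exact Finsupp.liftAddHom_apply_single _ w s
  have hcomm : ∀ (x : X) (r : R), vE x * ιE r = ιE (σ x r) * vE x + ιE (δ x r) := by
    intro x r
    apply Finsupp.addHom_ext
    intro w s
    change vE x (ιE r (Finsupp.single w s)) =
      ιE (σ x r) (vE x (Finsupp.single w s)) + ιE (δ x r) (Finsupp.single w s)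
    rw [hι, hv, hv, map_add, hι, hι, hι, hδ x r s, map_mul, Finsupp.single_add]
    abel
  let S : Subring E := Subring.closure (Set.range ιE ∪ Set.range vE)
  have hιS : ∀ r, ιE r ∈ S := fun r => Subring.subset_closure (Or.inl ⟨r, rfl⟩)
  have hvS : ∀ x, vE x ∈ S := fun x => Subring.subset_closure (Or.inr ⟨x, rfl⟩)
  let ι : R →+* S := ιE.codRestrict S hιS
  let v : X → S := fun x => ⟨vE x, hvS x⟩
  have hcommS : ∀ (x : X) (r : R), v x * ι r = ι (σ x r) * v x + ι (δ x r) := by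
    intro x r
    exact Subtype.ext (hcomm x r)
  let Φ : (FreeMonoid X →₀ R) →+ S := Finsupp.liftAddHom (fun w =>
    (AddMonoidHom.mulRight (FreeMonoid.lift v w)).comp ι.toAddMonoidHom)
  have hΦ : ∀ f, Φ f = f.sum (fun w r => ι r * FreeMonoid.lift v w) := fun f => rfl
  have hΦs : ∀ w r, Φ (Finsupp.single w r) = ι r * FreeMonoid.lift v w := by
    intro w r
    simp [Φ]
  have hιΦ : ∀ r f, ∃ g, ι r * Φ f = Φ g := by
    intro r f
    induction f using Finsupp.induction_linear with
    | zero => exact ⟨0, by simp⟩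
    | add f g hf hg =>
      obtain ⟨f', hf'⟩ := hf
      obtain ⟨g', hg'⟩ := hg
      exact ⟨f' + g', by rw [map_add, mul_add, hf', hg', map_add]⟩
    | single w s => exact ⟨Finsupp.single w (r * s), by rw [hΦs, hΦs, map_mul, mul_assoc]⟩
  have hvΦ : ∀ x f, ∃ g, v x * Φ f = Φ g := by
    intro x f
    induction f using Finsupp.induction_linear with
    | zero => exact ⟨0, by simp⟩
    | add f g hf hg =>
      obtain ⟨f', hf'⟩ := hf
      obtain ⟨g', hg'⟩ := hg
      exact ⟨f' + g', by rw [map_add, mul_add, hf', hg', map_add]⟩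
    | single w s =>
      refine ⟨Finsupp.single (FreeMonoid.of x * w) (σ x s) + Finsupp.single w (δ x s), ?_⟩
      rw [map_add, hΦs, hΦs, hΦs, ← mul_assoc, hcommS, map_mul, FreeMonoid.lift_eval_of,
        add_mul, mul_assoc]
  have hmul : ∀ s : S, ∀ f, ∃ g, s * Φ f = Φ g := by
    rintro ⟨s, hs⟩
    induction hs using Subring.closure_induction with
    | mem s hs =>
      intro f
      rcases hs with ⟨r, rfl⟩ | ⟨x, rfl⟩
      · exact hιΦ r f
      · exact hvΦ x f
    | zero => exact fun f => ⟨0, by rw [map_zero]; exact zero_mul _⟩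
    | one => exact fun f => ⟨f, one_mul _⟩
    | add s t hs ht h1 h2 =>
      intro f
      obtain ⟨f', hf'⟩ := h1 f
      obtain ⟨g', hg'⟩ := h2 f
      exact ⟨f' + g', by rw [map_add, ← hf', ← hg', ← add_mul]; rfl⟩
    | neg s hs h1 =>
      intro f
      obtain ⟨f', hf'⟩ := h1 f
      exact ⟨-f', by rw [map_neg, ← hf', ← neg_mul]; rfl⟩
    | mul s t hs ht h1 h2 =>
      intro f
      obtain ⟨f', hf'⟩ := h2 f
      obtain ⟨g', hg'⟩ := h1 f'
      exact ⟨g', by rw [← hg', ← hf', ← mul_assoc]; rfl⟩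
  have hword : ∀ w : FreeMonoid X, ((FreeMonoid.lift v w : S) : E) (Finsupp.single 1 1) =
      Finsupp.single w 1 := by
    intro w
    induction w using FreeMonoid.inductionOn' with
    | one => rfl
    | of_mul x w ih =>
      rw [map_mul, FreeMonoid.lift_eval_of]
      change vE x (((FreeMonoid.lift v w : S) : E) (Finsupp.single 1 1)) = _
      have h1 : δ x 1 = 0 := by simpa using hδ x 1 1
      rw [ih, hv, map_one, h1, Finsupp.single_zero, add_zero]
  have hev : ∀ f, ((Φ f : S) : E) (Finsupp.single 1 1) = f := by
    intro f
    induction f using Finsupp.induction_linear with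
    | zero => rw [map_zero]; rfl
    | add f g hf hg =>
      rw [map_add]
      change ((Φ f : S) : E) (Finsupp.single 1 1) + ((Φ g : S) : E) (Finsupp.single 1 1) = _
      rw [hf, hg]
    | single w s =>
      rw [hΦs]
      change ιE s (((FreeMonoid.lift v w : S) : E) (Finsupp.single 1 1)) = _
      rw [hword, hι, mul_one]
  have hinj : Function.Injective Φ := by
    intro f g h
    rw [← hev f, ← hev g, h]
  refine ⟨S, inferInstance, ι, v, ?_, ⟨hinj, ?_⟩, hcommS⟩
  · intro r s h
    have h1 : Φ (Finsupp.single 1 r) = Φ (Finsupp.single 1 s) := by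
      rw [hΦs, hΦs, h]
    exact Finsupp.single_injective _ (hinj h1)
  · intro s
    obtain ⟨g, hg⟩ := hmul s (Finsupp.single 1 1)
    refine ⟨g, ?_⟩
    change Φ g = s
    rw [← hg, hΦs, map_one, map_one, mul_one, mul_one]

/-!
Everything rests on comparing top-degree coefficients: for `g` of degree at most `k` and `f` of
degree at most `m`, the coefficient of `g f` at a word `u w` with `|u| = k` and `|w| = m` is
`g_u σ_u(f_w)`.

Let `P` be the prime radical, `P ^ n = 0`. By the `q`-Leibniz rule, for `p ∈ P`, `b ∈ P ^ k` the
only terms of `δ^{k+1}(p b)` that need not lie in `P` combine to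
`(1 + q + ⋯ + q^k) σ^k(δ p) δ^k(b)`. As the `q`-integer is invertible and `P` is semiprime, a
downward induction from `k = n` shows `δ^k(P ^ k) ⊆ P`, and `k = 1` says that `P` is `δ`-stable.
Reduction modulo `P` therefore maps `R[X; σ, δ]` onto a free skew extension of the semiprime left
Goldie ring `R / P`.

Over such a ring the Jacobson radical `J` vanishes. Otherwise its leading coefficients generate a
nonzero ideal `I`, which contains a `c` with `I ∩ ann c = 0`. Some `f ∈ J` of positive degree has
top coefficients with no more common left annihilators than `c` has. Modulo the stable ideal
`Q = ann I`, the top coefficients of `c f` have no common left annihilator, so no left multiple of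
`1 + c f` is `1`: its top-degree part cannot cancel. This contradicts `c f ∈ J`.

Hence the elements of `J(R[X; σ, δ])` have coefficients in `P`, and those of its `n`-th power have
coefficients in `P ^ n = 0`.
-/

section Semiprime

variable {R : Type*} [Ring R]

/-- A semiprime ideal, in the elementwise form `b R b ⊆ P → b ∈ P`. A semiprime ring is one whose
zero ideal is semiprime. -/
def IsSemiprimeIdeal (P : Ideal R) : Prop :=
  ∀ b : R, (∀ r, b * r * b ∈ P) → b ∈ P

theorem IsSemiprimeIdeal.bot_quotient {P : Ideal R} [P.IsTwoSided] (hP : IsSemiprimeIdeal P) :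
    IsSemiprimeIdeal (⊥ : Ideal (R ⧸ P)) := by
  intro b hb
  obtain ⟨b, rfl⟩ := Ideal.Quotient.mk_surjective b
  refine Ideal.Quotient.eq_zero_iff_mem.2 (hP b fun r => ?_)
  simpa only [← map_mul] using Ideal.Quotient.eq_zero_iff_mem.1 (hb (Ideal.Quotient.mk P r))

theorem isSemiprimeIdeal_primeRadical : IsSemiprimeIdeal (primeRadical R) := by
  intro b hb
  refine Submodule.mem_sInf.2 fun P hP => ?_
  simpa only [or_self] using hP.mem_or_mem b b fun r => Submodule.mem_sInf.1 (hb r) P hP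

end Semiprime

section LeftAnnihilator

variable {R : Type*} [Ring R]

theorem mem_leftAnnihilator {A : Set R} {r : R} : r ∈ leftAnnihilator A ↔ ∀ a ∈ A, r * a = 0 :=
  Iff.rfl

theorem mem_leftAnnihilator_singleton {a r : R} : r ∈ leftAnnihilator {a} ↔ r * a = 0 := by
  simp only [mem_leftAnnihilator, Set.mem_singleton_iff, forall_eq]

/-- The ascending chain condition on left annihilators of subsets of `R`. -/
abbrev LeftAnnihilatorACC (R : Type*) [Ring R] : Prop :=
  WellFoundedGT (Set.range (leftAnnihilator : Set R → Ideal R))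

theorem IsLeftGoldie.leftAnnihilatorACC (h : IsLeftGoldie R) : LeftAnnihilatorACC R := by
  refine wellFoundedGT_iff_monotone_chain_condition.2 fun L => ?_
  choose A hA using fun i => (L i).2
  obtain ⟨N, hN⟩ := h.acc_leftAnnihilator A fun i j hij =>
    (hA i).trans_le ((Subtype.coe_le_coe.2 (L.monotone hij)).trans_eq (hA j).symm)
  exact ⟨N, fun m hm => Subtype.ext (by rw [← hA, ← hA, hN m hm])⟩

theorem exists_leftAnnihilator_eq [LeftAnnihilatorACC R] {A : ℕ → Set R}
    (hA : Monotone fun i => leftAnnihilator (A i)) :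
    ∃ N, ∀ m, N ≤ m → leftAnnihilator (A N) = leftAnnihilator (A m) := by
  obtain ⟨N, hN⟩ := WellFoundedGT.monotone_chain_condition
    (α := Set.range (leftAnnihilator : Set R → Ideal R))
    ⟨fun i => ⟨leftAnnihilator (A i), A i, rfl⟩, hA⟩
  exact ⟨N, fun m hm => congrArg Subtype.val (hN m hm)⟩

theorem exists_maximal_leftAnnihilator_singleton [LeftAnnihilatorACC R] {T : Set R}
    (hT : T.Nonempty) :
    ∃ u ∈ T, ∀ w ∈ T, leftAnnihilator {u} ≤ leftAnnihilator {w} →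
      leftAnnihilator {w} ≤ leftAnnihilator {u} := by
  let ann : R → Set.range (leftAnnihilator : Set R → Ideal R) :=
    fun u => ⟨leftAnnihilator {u}, {u}, rfl⟩
  obtain ⟨_, ⟨u, hu, rfl⟩, hmax⟩ := wellFounded_gt.has_min (ann '' T) (hT.image ann)
  exact ⟨u, hu, fun w hw hle => not_not.1 fun hge => hmax (ann w) ⟨w, hw, rfl⟩ ⟨hle, hge⟩⟩

end LeftAnnihilator

section Regular

variable {R : Type*} [Ring R]

theorem exists_not_isNilpotent_mul [LeftAnnihilatorACC R] (hR : IsSemiprimeIdeal (⊥ : Ideal R))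
    {a : R} (ha : a ≠ 0) : ∃ r, ¬ IsNilpotent (a * r) := by
  by_contra! hnil
  obtain ⟨u, ⟨hu0, hunil⟩, hmax⟩ := exists_maximal_leftAnnihilator_singleton
    (T := {u | u ≠ 0 ∧ ∀ r, IsNilpotent (u * r)}) ⟨a, ha, hnil⟩
  have hann : ∀ y b, u * y ≠ 0 → b * (u * y) = 0 → b * u = 0 := by
    intro y b hy hb
    refine mem_leftAnnihilator_singleton.1 (hmax (u * y) ⟨hy, fun r => ?_⟩ (fun c hc => ?_)
      (mem_leftAnnihilator_singleton.2 hb))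
    · rw [mul_assoc]
      exact hunil _
    · rw [mem_leftAnnihilator_singleton] at hc ⊢
      rw [← mul_assoc, hc, zero_mul]
  obtain ⟨y, hy⟩ : ∃ y, u * y * u ≠ 0 := by
    by_contra! h
    exact hu0 (hR u h)
  have hpow : ∀ k, (u * y) ^ (k + 1) ≠ 0 := by
    intro k
    induction k with
    | zero => simpa only [zero_add, pow_one] using left_ne_zero_of_mul hy
    | succ k ih =>
      rw [pow_succ', mul_assoc] at ih
      intro h
      rw [pow_succ', pow_succ' _ k, mul_assoc u y (_ ^ k)] at h
      exact hy (hann _ _ ih h)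
  obtain ⟨k, hk⟩ := hunil y
  exact hpow k (by rw [pow_succ, hk, zero_mul])

theorem exists_mem_not_isNilpotent [LeftAnnihilatorACC R] (hR : IsSemiprimeIdeal (⊥ : Ideal R))
    {I : Ideal R} (hI : I ≠ ⊥) : ∃ a ∈ I, ¬ IsNilpotent a := by
  obtain ⟨a, haI, ha⟩ := Submodule.exists_mem_ne_zero_of_ne_bot hI
  obtain ⟨r, hr⟩ := exists_not_isNilpotent_mul hR ha
  refine ⟨r * a, I.mul_mem_left r haI, fun ⟨k, hk⟩ => hr ⟨k + 1, ?_⟩⟩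
  have : SemiconjBy a (r * a) (a * r) := (mul_assoc a r a).symm
  rw [pow_succ, ← mul_assoc, ← (this.pow_right k).eq, hk, mul_zero, zero_mul]

theorem exists_mem_leftAnnihilator_sq_le [LeftAnnihilatorACC R]
    (hR : IsSemiprimeIdeal (⊥ : Ideal R)) {I : Ideal R} (hI : I ≠ ⊥) :
    ∃ a ∈ I, a ≠ 0 ∧ leftAnnihilator {a * a} ≤ leftAnnihilator {a} := by
  obtain ⟨a, haI, ha⟩ := exists_mem_not_isNilpotent hR hI
  obtain ⟨N, hN⟩ := exists_leftAnnihilator_eq (A := fun i => {a ^ i}) <|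
    monotone_nat_of_le_succ fun i b hb => by
      rw [mem_leftAnnihilator_singleton] at hb ⊢
      rw [pow_succ, ← mul_assoc, hb, zero_mul]
  refine ⟨a ^ (N + 1), ?_, fun h => ha ⟨_, h⟩, ?_⟩
  · rw [pow_succ]
    exact I.mul_mem_left _ haI
  · rw [← pow_add, ← hN (N + 1) (by lia), ← hN (N + 1 + (N + 1)) (by lia)]

theorem mul_eq_zero_of_sum_mul_eq_zero {ι : Type*} [LinearOrder ι] {a : ι → R}
    (hsq : ∀ i, leftAnnihilator {a i * a i} ≤ leftAnnihilator {a i}) {t : Finset ι}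
    (horth : ∀ i ∈ t, ∀ j ∈ t, i < j → a j * a i = 0) {r : ι → R}
    (hsum : ∑ i ∈ t, r i * a i = 0) : ∀ i ∈ t, r i * a i = 0 := by
  induction t using Finset.induction_on_min with
  | empty => simp only [Finset.notMem_empty, false_imp_iff, implies_true]
  | insert i t hi ih =>
    rw [Finset.forall_mem_insert]
    rw [Finset.sum_insert fun h => (hi i h).false] at hsum
    have hri : r i * a i = 0 := by
      refine mem_leftAnnihilator_singleton.1 (hsq i (mem_leftAnnihilator_singleton.2 ?_))
      have htail : (∑ j ∈ t, r j * a j) * a i = 0 := by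
        rw [Finset.sum_mul]
        refine Finset.sum_eq_zero fun j hj => ?_
        rw [mul_assoc, horth i (Finset.mem_insert_self i t) j (Finset.mem_insert_of_mem hj)
          (hi j hj), mul_zero]
      have := congrArg (· * a i) hsum
      simpa only [add_mul, htail, add_zero, zero_mul, mul_assoc] using this
    rw [hri, zero_add] at hsum
    exact ⟨hri, ih (fun j hj k hk => horth j (Finset.mem_insert_of_mem hj) k
      (Finset.mem_insert_of_mem hk)) hsum⟩

theorem iSupIndep_span_singleton {ι : Type*} [LinearOrder ι] {a : ι → R}
    (hsq : ∀ i, leftAnnihilator {a i * a i} ≤ leftAnnihilator {a i})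
    (horth : ∀ i j, i < j → a j * a i = 0) : iSupIndep fun i => Ideal.span {a i} := by
  rw [iSupIndep_iff_finsetSum_eq_zero_imp_eq_zero]
  intro t b hb hsum
  have : ∀ i, ∃ r, i ∈ t → r * a i = b i := fun i => by
    by_cases hi : i ∈ t
    · exact (Ideal.mem_span_singleton'.1 (hb i hi)).imp fun _ h _ => h
    · exact ⟨0, fun h => (hi h).elim⟩
  choose r hr using this
  intro i hi
  rw [← hr i hi]
  refine mul_eq_zero_of_sum_mul_eq_zero hsq (fun i _ j _ => horth i j) ?_ i hi
  rwa [Finset.sum_congr rfl hr]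

theorem exists_seq_mul_eq_zero {I : Ideal R}
    (hI : ∀ c ∈ I, ∃ a ∈ I, a ≠ 0 ∧ a * c = 0 ∧ leftAnnihilator {a * a} ≤ leftAnnihilator {a}) :
    ∃ a : ℕ → R, (∀ i, a i ≠ 0) ∧ (∀ i, leftAnnihilator {a i * a i} ≤ leftAnnihilator {a i}) ∧
      ∀ i j, i < j → a j * a i = 0 := by
  choose! α hαI hα0 hαc hαsq using hI
  let c : ℕ → R := fun k => (fun c => c + α c)^[k] 0
  have c_succ : ∀ k, c (k + 1) = c k + α (c k) := fun k => Function.iterate_succ_apply' _ k 0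
  have hcI : ∀ k, c k ∈ I := fun k => by
    induction k with
    | zero => exact I.zero_mem
    | succ k ih => exact c_succ k ▸ I.add_mem ih (hαI _ ih)
  have c_eq_sum : ∀ k, c k = ∑ i ∈ Finset.range k, α (c i) := fun k => by
    induction k with
    | zero => rfl
    | succ k ih => rw [Finset.sum_range_succ, ← ih, c_succ]
  refine ⟨fun k => α (c k), fun k => hα0 _ (hcI k), fun k => hαsq _ (hcI k), fun i j hij => ?_⟩
  induction j using Nat.strong_induction_on generalizing i with
  | _ j ih =>
    refine mul_eq_zero_of_sum_mul_eq_zero (t := Finset.range j) (r := fun _ => α (c j))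
      (fun k => hαsq _ (hcI k)) (fun k _ l hl => ih l (Finset.mem_range.1 hl) k) ?_ i
      (Finset.mem_range.2 hij)
    rw [← Finset.mul_sum, ← c_eq_sum, hαc _ (hcI j)]

theorem IsLeftGoldie.exists_mem_inf_leftAnnihilator_eq_bot (h : IsLeftGoldie R)
    (hR : IsSemiprimeIdeal (⊥ : Ideal R)) (I : Ideal R) :
    ∃ c ∈ I, I ⊓ leftAnnihilator {c} = ⊥ := by
  have := h.leftAnnihilatorACC
  by_contra! hI
  obtain ⟨a, ha0, hsq, horth⟩ := exists_seq_mul_eq_zero (I := I) fun c hc => by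
    obtain ⟨a, ⟨haI, hac⟩, ha0, hsq⟩ := exists_mem_leftAnnihilator_sq_le hR (hI c hc)
    exact ⟨a, haI, ha0, mem_leftAnnihilator_singleton.1 hac, hsq⟩
  exact h.no_infinite_direct_sum ⟨fun i => Ideal.span {a i},
    fun i => Ideal.span_singleton_eq_bot.not.2 (ha0 i), iSupIndep_span_singleton hsq horth⟩

end Regular

section AnnihilatorOfIdeal

variable {R : Type*} [Ring R] {I : Ideal R}

instance leftAnnihilator_isTwoSided : (leftAnnihilator (I : Set R)).IsTwoSided where
  mul_mem_of_left b ha c hc := by rw [mul_assoc, ha _ (I.mul_mem_left b hc)]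

theorem inf_leftAnnihilator_eq_bot (hR : IsSemiprimeIdeal (⊥ : Ideal R)) :
    I ⊓ leftAnnihilator (I : Set R) = ⊥ := by
  refine (Submodule.eq_bot_iff _).2 fun b ⟨hbI, hb⟩ => hR b fun r => ?_
  rw [Submodule.mem_bot, mul_assoc, hb _ (I.mul_mem_left r hbI)]

theorem leftAnnihilator_singleton_le [I.IsTwoSided] (hR : IsSemiprimeIdeal (⊥ : Ideal R)) {c : R}
    (hc : I ⊓ leftAnnihilator {c} = ⊥) :
    leftAnnihilator {c} ≤ leftAnnihilator (I : Set R) := by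
  intro b hb a ha
  refine hR _ fun r => ?_
  have harb : a * r * b ∈ I ⊓ leftAnnihilator {c} := by
    refine ⟨I.mul_mem_right b (I.mul_mem_right r ha), mem_leftAnnihilator_singleton.2 ?_⟩
    rw [mul_assoc, mem_leftAnnihilator_singleton.1 hb, mul_zero]
  rw [hc, Submodule.mem_bot] at harb
  rw [Submodule.mem_bot, show b * a * r * (b * a) = b * (a * r * b) * a by noncomm_ring, harb,
    mul_zero, zero_mul]

variable {σ : R →+* R}

theorem comap_leftAnnihilator_le (hσ : Function.Injective σ) (hI : I ≤ I.comap σ) :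
    (leftAnnihilator (I : Set R)).comap σ ≤ leftAnnihilator (I : Set R) := by
  intro a ha c hc
  refine (map_eq_zero_iff σ hσ).1 ?_
  rw [map_mul, ha _ (hI hc)]

theorem le_comap_leftAnnihilator [LeftAnnihilatorACC R] (hσ : Function.Bijective σ)
    {A : Set R} (hA : (leftAnnihilator A).comap σ ≤ leftAnnihilator A) :
    leftAnnihilator A ≤ (leftAnnihilator A).comap σ := by
  have hmem : ∀ i b, σ^[i] b ∈ leftAnnihilator (σ^[i] '' A) ↔ b ∈ leftAnnihilator A := by
    intro i b
    simp only [mem_leftAnnihilator, Set.forall_mem_image, ← iterate_map_mul]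
    exact forall₂_congr fun c _ => (hσ.injective.iterate i).eq_iff' (iterate_map_zero σ i)
  obtain ⟨N, hN⟩ := exists_leftAnnihilator_eq (A := fun i => σ^[i] '' A) <|
    monotone_nat_of_le_succ fun i b hb => by
      obtain ⟨b, rfl⟩ := hσ.surjective.iterate (i + 1) b
      rw [Function.iterate_succ_apply, hmem] at hb
      exact (hmem (i + 1) b).2 (hA hb)
  intro a ha
  have hmem_succ := (hmem (N + 1) a).2 ha
  rwa [← hN (N + 1) N.le_succ, Function.iterate_succ_apply, hmem] at hmem_succ

theorem IsSkewDerivation.apply_mem_leftAnnihilator {δ : R →+ R} (hδ : IsSkewDerivation σ δ)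
    (hR : IsSemiprimeIdeal (⊥ : Ideal R))
    (hσ : leftAnnihilator (I : Set R) ≤ (leftAnnihilator (I : Set R)).comap σ) {a : R}
    (ha : a ∈ leftAnnihilator (I : Set R)) : δ a ∈ leftAnnihilator (I : Set R) := by
  intro c hc
  have hac : δ a * c = -(σ a * δ c) := by
    rw [eq_neg_iff_add_eq_zero, ← hδ, ha c hc, map_zero]
  rw [← Submodule.mem_bot (R := R), ← inf_leftAnnihilator_eq_bot hR (I := I)]
  refine ⟨I.mul_mem_left _ hc, ?_⟩
  rw [hac]
  exact neg_mem (Ideal.mul_mem_right _ _ (hσ ha))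

end AnnihilatorOfIdeal

section FreeMonoid

variable {X : Type*}

theorem freeMonoid_of_mul_inj {x y : X} {u w : FreeMonoid X} :
    FreeMonoid.of x * u = FreeMonoid.of y * w ↔ x = y ∧ u = w :=
  List.cons_eq_cons

theorem freeMonoid_eq_of_length_eq [Subsingleton X] {u w : FreeMonoid X}
    (h : u.length = w.length) : u = w :=
  List.ext_getElem h fun _ _ _ => Subsingleton.elim _ _

theorem freeMonoid_lift_bijective {R : Type*} [Ring R] {σ : X → R →+* R}
    (hσ : ∀ x, Function.Bijective (σ x)) (u : FreeMonoid X) :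
    Function.Bijective (FreeMonoid.lift σ u) := by
  induction u using FreeMonoid.inductionOn' with
  | one => exact Function.bijective_id
  | of_mul x u ih =>
    rw [map_mul, FreeMonoid.lift_eval_of]
    exact (hσ x).comp ih

end FreeMonoid

theorem skewVarEnd_single {R X : Type*} [Ring R] (σ : X → R →+* R) (δ : X → R →+ R) (x : X)
    (w : FreeMonoid X) (r : R) : skewVarEnd σ δ x (Finsupp.single w r) =
      Finsupp.single (FreeMonoid.of x * w) (σ x r) + Finsupp.single w (δ x r) :=
  Finsupp.liftAddHom_apply_single _ w r

namespace IsFreeSkewExtension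

variable {R X S : Type*} [Ring R] [Ring S] {σ : X → R →+* R} {δ : X → R →+ R} {ι : R →+* S}
  {v : X → S}

section Coefficients

/-- The additive isomorphism `∑ r_w w ↦ ∑ r_w w` from finitely supported families of coefficients
to the free skew extension. -/
noncomputable def equiv (hS : IsFreeSkewExtension σ δ ι v) : (FreeMonoid X →₀ R) ≃+ S :=
  AddEquiv.ofBijective (Finsupp.liftAddHom fun w =>
    (AddMonoidHom.mulRight (FreeMonoid.lift v w)).comp ι.toAddMonoidHom) hS.basis

/-- The family of left coefficients `r_w` of an element `∑ r_w w` of the free skew extension. -/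
noncomputable def coeff (hS : IsFreeSkewExtension σ δ ι v) : S →+ FreeMonoid X →₀ R :=
  hS.equiv.symm.toAddMonoidHom

variable (hS : IsFreeSkewExtension σ δ ι v)

theorem equiv_single (w : FreeMonoid X) (r : R) :
    hS.equiv (Finsupp.single w r) = ι r * FreeMonoid.lift v w := by
  simp [equiv]

theorem equiv_coeff (s : S) : hS.equiv (hS.coeff s) = s :=
  hS.equiv.apply_symm_apply s

theorem sum_coeff (s : S) :
    ((hS.coeff s).sum fun w r => ι r * FreeMonoid.lift v w) = s :=
  hS.equiv_coeff s

theorem coeff_injective : Function.Injective hS.coeff :=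
  hS.equiv.symm.injective

theorem coeff_monomial (w : FreeMonoid X) (r : R) :
    hS.coeff (ι r * FreeMonoid.lift v w) = Finsupp.single w r := by
  rw [← hS.equiv_single]
  exact hS.equiv.symm_apply_apply _

theorem coeff_ι (r : R) : hS.coeff (ι r) = Finsupp.single 1 r := by
  simpa only [map_one, mul_one] using hS.coeff_monomial 1 r

theorem coeff_one : hS.coeff 1 = Finsupp.single 1 1 := by
  simpa only [map_one] using hS.coeff_ι 1

theorem coeff_v (x : X) : hS.coeff (v x) = Finsupp.single (FreeMonoid.of x) 1 := by
  simpa only [map_one, one_mul, FreeMonoid.lift_eval_of] using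
    hS.coeff_monomial (FreeMonoid.of x) 1

include hS in
theorem monomial_induction {p : S → Prop} (zero : p 0) (add : ∀ s t, p s → p t → p (s + t))
    (monomial : ∀ r w, p (ι r * FreeMonoid.lift v w)) (s : S) : p s := by
  rw [← hS.sum_coeff s, Finsupp.sum]
  exact Finset.sum_induction _ p add zero fun w _ => monomial _ w

theorem coeff_ι_mul (r : R) (s : S) (w : FreeMonoid X) :
    hS.coeff (ι r * s) w = r * hS.coeff s w := by
  induction s using hS.monomial_induction with
  | zero => simp only [mul_zero, map_zero, Finsupp.zero_apply]
  | add s t hs ht => simp only [mul_add, map_add, Finsupp.add_apply, hs, ht]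
  | monomial a z =>
    rw [← mul_assoc, ← map_mul, coeff_monomial, coeff_monomial, ← smul_eq_mul, ← smul_eq_mul,
      ← Finsupp.smul_single, Finsupp.smul_apply]

theorem coeff_v_mul (x : X) (s : S) :
    hS.coeff (v x * s) = skewVarEnd σ δ x (hS.coeff s) := by
  induction s using hS.monomial_induction with
  | zero => simp only [mul_zero, map_zero]
  | add s t hs ht => simp only [mul_add, map_add, hs, ht]
  | monomial a z =>
    rw [← mul_assoc, hS.commutation, add_mul, map_add, mul_assoc, ← FreeMonoid.lift_eval_of v x,
      ← map_mul, coeff_monomial, coeff_monomial, coeff_monomial, skewVarEnd_single]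

theorem coeff_v_mul_one (x : X) (s : S) : hS.coeff (v x * s) 1 = δ x (hS.coeff s 1) := by
  classical
  rw [coeff_v_mul]
  induction hS.coeff s using Finsupp.induction_linear with
  | zero => simp only [map_zero, Finsupp.zero_apply]
  | add f g hf hg => simp only [map_add, Finsupp.add_apply, hf, hg]
  | single z r =>
    have : FreeMonoid.of x * z ≠ 1 := List.cons_ne_nil x z
    rw [skewVarEnd_single, Finsupp.add_apply, Finsupp.single_eq_of_ne' this, zero_add,
      Finsupp.single_apply, Finsupp.single_apply, apply_ite (δ x), map_zero]

theorem coeff_v_mul_of_mul [DecidableEq X] (x : X) (s : S) (y : X) (w : FreeMonoid X) :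
    hS.coeff (v x * s) (FreeMonoid.of y * w) =
      (if x = y then σ x (hS.coeff s w) else 0) + δ x (hS.coeff s (FreeMonoid.of y * w)) := by
  classical
  rw [coeff_v_mul]
  induction hS.coeff s using Finsupp.induction_linear with
  | zero => simp only [map_zero, Finsupp.zero_apply, ite_self, add_zero]
  | add f g hf hg =>
    simp only [map_add, Finsupp.add_apply, hf, hg]
    split_ifs <;> abel
  | single z r =>
    simp only [skewVarEnd_single, Finsupp.add_apply, Finsupp.single_apply, freeMonoid_of_mul_inj,
      apply_ite (σ x), apply_ite (δ x), map_zero, ite_and]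

theorem coeff_mul (g f : S) (z : FreeMonoid X) : hS.coeff (g * f) z =
    (hS.coeff g).sum fun u b => b * hS.coeff (FreeMonoid.lift v u * f) z := by
  conv_lhs => rw [← hS.sum_coeff g]
  simp only [Finsupp.sum, Finset.sum_mul, map_sum, Finsupp.finsetSum_apply, mul_assoc, coeff_ι_mul]

theorem coeff_mul_mem {I : Ideal R} {g f : S} {z : FreeMonoid X}
    (h : ∀ u, hS.coeff g u * hS.coeff (FreeMonoid.lift v u * f) z ∈ I) :
    hS.coeff (g * f) z ∈ I := by
  rw [coeff_mul]
  exact sum_mem fun u _ => h u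

end Coefficients

section Degree

variable (hS : IsFreeSkewExtension σ δ ι v)

/-- The elements of degree at most `m`: their coefficients at words longer than `m` vanish. -/
def degreeLE (m : ℕ) : AddSubgroup S where
  carrier := {s | ∀ w : FreeMonoid X, m < w.length → hS.coeff s w = 0}
  zero_mem' w _ := by rw [map_zero, Finsupp.zero_apply]
  add_mem' hs ht w hw := by rw [map_add, Finsupp.add_apply, hs w hw, ht w hw, add_zero]
  neg_mem' hs w hw := by rw [map_neg, Finsupp.neg_apply, hs w hw, neg_zero]

variable {hS} {k m : ℕ} {f g : S}

theorem length_le_of_mem_degreeLE (hf : f ∈ hS.degreeLE m) {w : FreeMonoid X}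
    (hw : w ∈ (hS.coeff f).support) : w.length ≤ m :=
  not_lt.1 fun h => Finsupp.mem_support_iff.1 hw (hf w h)

theorem monomial_mem_degreeLE (r : R) (w : FreeMonoid X) :
    ι r * FreeMonoid.lift v w ∈ hS.degreeLE w.length := fun z hz => by
  rw [coeff_monomial, Finsupp.single_eq_of_ne]
  rintro rfl
  exact hz.false

theorem ι_mem_degreeLE (r : R) : ι r ∈ hS.degreeLE 0 := by
  simpa only [map_one, mul_one, FreeMonoid.length_one] using hS.monomial_mem_degreeLE r 1

theorem v_mem_degreeLE (x : X) : v x ∈ hS.degreeLE 1 := by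
  simpa only [map_one, one_mul, FreeMonoid.lift_eval_of, FreeMonoid.length_of] using
    hS.monomial_mem_degreeLE 1 (FreeMonoid.of x)

theorem exists_mem_degreeLE_coeff_ne_zero (hf : f ≠ 0) :
    ∃ w : FreeMonoid X, f ∈ hS.degreeLE w.length ∧ hS.coeff f w ≠ 0 := by
  have hsupp : (hS.coeff f).support.Nonempty :=
    Finsupp.support_nonempty_iff.2 ((map_ne_zero_iff _ hS.coeff_injective).2 hf)
  obtain ⟨w, hw, hmax⟩ := Finset.exists_max_image _ FreeMonoid.length hsupp
  exact ⟨w, fun z hz => Finsupp.notMem_support_iff.1 fun h => hz.not_ge (hmax z h),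
    Finsupp.mem_support_iff.1 hw⟩

theorem v_mul_mem_degreeLE (hf : f ∈ hS.degreeLE m) (x : X) : v x * f ∈ hS.degreeLE (m + 1) := by
  classical
  intro z hz
  induction z using FreeMonoid.casesOn with
  | one => simp only [FreeMonoid.length_one, not_lt_zero] at hz
  | of_mul y z =>
    have hlen : (FreeMonoid.of y * z).length = 1 + z.length := by
      rw [FreeMonoid.length_mul, FreeMonoid.length_of]
    rw [coeff_v_mul_of_mul, hf z (by lia), hf _ (by lia), map_zero, map_zero, ite_self, add_zero]

theorem word_mul_mem_degreeLE (hf : f ∈ hS.degreeLE m) (u : FreeMonoid X) :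
    FreeMonoid.lift v u * f ∈ hS.degreeLE (u.length + m) := by
  induction u using FreeMonoid.inductionOn' with
  | one => simpa only [map_one, one_mul, FreeMonoid.length_one, zero_add] using hf
  | of_mul x u ih =>
    rw [map_mul, FreeMonoid.lift_eval_of, mul_assoc, FreeMonoid.length_mul, FreeMonoid.length_of,
      add_assoc, add_comm]
    exact v_mul_mem_degreeLE ih x

theorem coeff_word_mul_of_length_eq [DecidableEq (FreeMonoid X)] (hf : f ∈ hS.degreeLE m)
    {u u' w : FreeMonoid X} (hu : u.length = u'.length) (hw : w.length = m) :
    hS.coeff (FreeMonoid.lift v u * f) (u' * w) =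
      if u = u' then FreeMonoid.lift σ u (hS.coeff f w) else 0 := by
  classical
  induction u using FreeMonoid.inductionOn' generalizing u' with
  | one =>
    obtain rfl : u' = 1 := FreeMonoid.length_eq_zero.1 hu.symm
    simp only [map_one, one_mul, if_true, RingHom.one_def, RingHom.id_apply]
  | of_mul x u ih =>
    induction u' using FreeMonoid.casesOn with
    | one => simp [FreeMonoid.length_mul] at hu
    | of_mul y z =>
      have hlen : u.length = z.length := by
        simpa only [FreeMonoid.length_mul, FreeMonoid.length_of, add_right_inj] using hu
      have htop : hS.coeff (FreeMonoid.lift v u * f) (FreeMonoid.of y * (z * w)) = 0 :=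
        word_mul_mem_degreeLE hf u _ <| by
          rw [FreeMonoid.length_mul, FreeMonoid.length_mul, FreeMonoid.length_of]
          lia
      rw [map_mul (FreeMonoid.lift v), map_mul (FreeMonoid.lift σ), FreeMonoid.lift_eval_of,
        FreeMonoid.lift_eval_of, mul_assoc, mul_assoc, coeff_v_mul_of_mul, htop, ih hlen, map_zero,
        add_zero, apply_ite (σ x), map_zero]
      simp only [freeMonoid_of_mul_inj, ite_and, RingHom.mul_def, RingHom.comp_apply]

theorem mul_mem_degreeLE (hg : g ∈ hS.degreeLE k) (hf : f ∈ hS.degreeLE m) :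
    g * f ∈ hS.degreeLE (k + m) := by
  intro z hz
  rw [coeff_mul]
  refine Finset.sum_eq_zero fun u hu => ?_
  have := length_le_of_mem_degreeLE hg hu
  dsimp only
  rw [word_mul_mem_degreeLE hf u z (by lia), mul_zero]

theorem coeff_mul_of_mem_degreeLE (hg : g ∈ hS.degreeLE k) (hf : f ∈ hS.degreeLE m)
    {u w : FreeMonoid X} (hu : u.length = k) (hw : w.length = m) :
    hS.coeff (g * f) (u * w) = hS.coeff g u * FreeMonoid.lift σ u (hS.coeff f w) := by
  classical
  rw [coeff_mul, Finsupp.sum, Finset.sum_eq_single u]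
  · rw [coeff_word_mul_of_length_eq hf rfl hw, if_pos rfl]
  · intro u' hu' hne
    rcases (length_le_of_mem_degreeLE hg hu').lt_or_eq with hlt | heq
    · rw [word_mul_mem_degreeLE hf u' _ (by rw [FreeMonoid.length_mul]; lia), mul_zero]
    · rw [coeff_word_mul_of_length_eq hf (heq.trans hu.symm) hw, if_neg hne, mul_zero]
  · intro h
    rw [Finsupp.notMem_support_iff.1 h, zero_mul]

theorem coeff_mul_v_of_mem_degreeLE [DecidableEq X] (hf : f ∈ hS.degreeLE m) {w : FreeMonoid X}
    (hw : w.length = m) (x y : X) :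
    hS.coeff (f * v x) (w * FreeMonoid.of y) = if x = y then hS.coeff f w else 0 := by
  classical
  rw [coeff_mul_of_mem_degreeLE hf (v_mem_degreeLE x) hw (FreeMonoid.length_of y), coeff_v,
    Finsupp.single_apply]
  simp only [FreeMonoid.of_injective.eq_iff, apply_ite (FreeMonoid.lift σ w), map_one, map_zero,
    mul_ite, mul_one, mul_zero]

end Degree

end IsFreeSkewExtension

section Lift

variable {R X S T : Type*} [Ring R] [Ring S] [Semiring T] {σ : X → R →+* R} {δ : X → R →+ R}
  {ι : R →+* S} {v : X → S}

namespace IsFreeSkewExtension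

variable (hS : IsFreeSkewExtension σ δ ι v) (f : R →+* T) (y : X → T)

/-- The additive map `∑ r_w w ↦ ∑ f(r_w) w(y)` underlying `IsFreeSkewExtension.lift`. -/
noncomputable def liftAddHom : S →+ T :=
  (Finsupp.liftAddHom fun w =>
    (AddMonoidHom.mulRight (FreeMonoid.lift y w)).comp f.toAddMonoidHom).comp hS.coeff

theorem liftAddHom_monomial (r : R) (w : FreeMonoid X) :
    hS.liftAddHom f y (ι r * FreeMonoid.lift v w) = f r * FreeMonoid.lift y w := by
  rw [liftAddHom, AddMonoidHom.comp_apply, coeff_monomial, Finsupp.liftAddHom_apply_single]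
  rfl

theorem liftAddHom_ι_mul (r : R) (s : S) :
    hS.liftAddHom f y (ι r * s) = f r * hS.liftAddHom f y s := by
  induction s using hS.monomial_induction with
  | zero => simp only [mul_zero, map_zero]
  | add s t hs ht => simp only [mul_add, map_add, hs, ht]
  | monomial a w =>
    rw [← mul_assoc, ← map_mul, liftAddHom_monomial, liftAddHom_monomial, map_mul, mul_assoc]

variable {f y} (hy : ∀ x r, y x * f r = f (σ x r) * y x + f (δ x r))
include hy

theorem liftAddHom_v_mul (x : X) (s : S) :
    hS.liftAddHom f y (v x * s) = y x * hS.liftAddHom f y s := by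
  induction s using hS.monomial_induction with
  | zero => simp only [mul_zero, map_zero]
  | add s t hs ht => simp only [mul_add, map_add, hs, ht]
  | monomial a w =>
    rw [← mul_assoc, hS.commutation, add_mul, map_add, mul_assoc, ← FreeMonoid.lift_eval_of v x,
      ← map_mul, liftAddHom_monomial, liftAddHom_monomial, liftAddHom_monomial, map_mul,
      FreeMonoid.lift_eval_of, ← mul_assoc (y x), hy, add_mul, mul_assoc]

theorem liftAddHom_word_mul (w : FreeMonoid X) (s : S) :
    hS.liftAddHom f y (FreeMonoid.lift v w * s) = FreeMonoid.lift y w * hS.liftAddHom f y s := by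
  induction w using FreeMonoid.inductionOn' with
  | one => simp only [map_one, one_mul]
  | of_mul x w ih =>
    rw [map_mul (FreeMonoid.lift v), map_mul (FreeMonoid.lift y), FreeMonoid.lift_eval_of,
      FreeMonoid.lift_eval_of, mul_assoc, hS.liftAddHom_v_mul hy, ih, mul_assoc]

/-- The universal property of the free skew extension: a ring homomorphism on `R`, together with
images of the `x ∈ X` satisfying the commutation rule, extends to the free skew extension. -/
noncomputable def lift : S →+* T where
  __ := hS.liftAddHom f y
  map_one' := by
    change hS.liftAddHom f y 1 = 1
    simpa only [map_one, mul_one] using hS.liftAddHom_monomial f y 1 1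
  map_mul' s t := by
    change hS.liftAddHom f y (s * t) = hS.liftAddHom f y s * hS.liftAddHom f y t
    induction s using hS.monomial_induction with
    | zero => simp only [zero_mul, map_zero]
    | add s s' hs hs' => simp only [add_mul, map_add, hs, hs']
    | monomial a w => rw [mul_assoc, liftAddHom_ι_mul, liftAddHom_word_mul hS hy,
        liftAddHom_monomial, mul_assoc]

theorem lift_monomial (r : R) (w : FreeMonoid X) :
    hS.lift hy (ι r * FreeMonoid.lift v w) = f r * FreeMonoid.lift y w :=
  hS.liftAddHom_monomial f y r w

end IsFreeSkewExtension

end Lift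

section Quotient

/-- The additive map induced on `R ⧸ P` by an additive map preserving `P`. -/
def quotientAddHom {R : Type*} [Ring R] (P : Ideal R) (δ : R →+ R) (hδ : ∀ a ∈ P, δ a ∈ P) :
    R ⧸ P →+ R ⧸ P :=
  QuotientAddGroup.map P.toAddSubgroup P.toAddSubgroup δ hδ

theorem IsSkewDerivation.quotient {R : Type*} [Ring R] {P : Ideal R} [P.IsTwoSided] {σ : R →+* R}
    {δ : R →+ R} (hδ : IsSkewDerivation σ δ) (hσP : P ≤ P.comap σ) (hδP : ∀ a ∈ P, δ a ∈ P) :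
    IsSkewDerivation (Ideal.quotientMap P σ hσP) (quotientAddHom P δ hδP) := by
  intro a b
  obtain ⟨a, rfl⟩ := Ideal.Quotient.mk_surjective a
  obtain ⟨b, rfl⟩ := Ideal.Quotient.mk_surjective b
  exact congrArg (Ideal.Quotient.mk P) (hδ a b)

namespace IsFreeSkewExtension

universe u w

variable {R : Type u} {X : Type w} {S : Type*} [Ring R] [Ring S] {σ : X → R →+* R}
  {δ : X → R →+ R} {ι : R →+* S} {v : X → S}

theorem exists_quotient (hS : IsFreeSkewExtension σ δ ι v) (hδ : ∀ x, IsSkewDerivation (σ x) (δ x))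
    {P : Ideal R} [P.IsTwoSided] (hσP : ∀ x, P ≤ P.comap (σ x)) (hδP : ∀ x, ∀ a ∈ P, δ x a ∈ P) :
    ∃ (S' : Type (max u w)) (_ : Ring S') (ι' : R ⧸ P →+* S') (v' : X → S')
      (hS' : IsFreeSkewExtension (fun x => Ideal.quotientMap P (σ x) (hσP x))
        (fun x => quotientAddHom P (δ x) (hδP x)) ι' v') (φ : S →+* S'),
      Function.Surjective φ ∧ ∀ s w, hS'.coeff (φ s) w = Ideal.Quotient.mk P (hS.coeff s w) := by
  obtain ⟨S', _, ι', v', hS'⟩ :=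
    exists_isFreeSkewExtension _ _ fun x => (hδ x).quotient (hσP x) (hδP x)
  have hy : ∀ x r, v' x * (ι'.comp (Ideal.Quotient.mk P)) r =
      (ι'.comp (Ideal.Quotient.mk P)) (σ x r) * v' x + (ι'.comp (Ideal.Quotient.mk P)) (δ x r) :=
    fun x r => hS'.commutation x (Ideal.Quotient.mk P r)
  refine ⟨S', inferInstance, ι', v', hS', hS.lift hy, fun t => ?_, fun s w => ?_⟩
  · induction t using hS'.monomial_induction with
    | zero => exact ⟨0, map_zero _⟩
    | add s t hs ht =>
      obtain ⟨s, rfl⟩ := hs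
      obtain ⟨t, rfl⟩ := ht
      exact ⟨s + t, map_add _ s t⟩
    | monomial r w =>
      obtain ⟨r, rfl⟩ := Ideal.Quotient.mk_surjective r
      exact ⟨_, hS.lift_monomial hy r w⟩
  · induction s using hS.monomial_induction with
    | zero => simp only [map_zero, Finsupp.zero_apply]
    | add s t hs ht => simp only [map_add, Finsupp.add_apply, hs, ht]
    | monomial r z =>
      classical
      rw [lift_monomial, RingHom.comp_apply, coeff_monomial, coeff_monomial, Finsupp.single_apply,
        Finsupp.single_apply, apply_ite (Ideal.Quotient.mk P), map_zero]

end IsFreeSkewExtension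

end Quotient

section Jacobson

variable {R X S : Type*} [Ring R] [Ring S] {σ : X → R →+* R} {δ : X → R →+ R} {ι : R →+* S}
  {v : X → S}

namespace IsFreeSkewExtension

section TopCoefficients

/-- The leading coefficients of degree `k` of an ideal `J`: the coefficients at words of length `k`
of the elements of `J` of degree at most `k`. -/
def topCoeffs (hS : IsFreeSkewExtension σ δ ι v) (J : Ideal S) (k : ℕ) : Set R :=
  {c | ∃ f ∈ J, f ∈ hS.degreeLE k ∧ ∃ w : FreeMonoid X, w.length = k ∧ hS.coeff f w = c}

/-- The left ideal generated by all leading coefficients of `J`. -/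
def topCoeffIdeal (hS : IsFreeSkewExtension σ δ ι v) (J : Ideal S) : Ideal R :=
  Ideal.span (⋃ k, hS.topCoeffs J k)

/-- The elements `c` of `R` dominated by some `f ∈ J` of degree at most `k`: every `b ∈ R` that
annihilates all coefficients of `f` at words of length `k` annihilates `c`. Unlike the leading
coefficients, the dominated elements of all degrees together form a left ideal even if `X` has
several elements, since two elements `f` and `g` of `J` can be placed side by side in
`f * v x + g * v y` for `x ≠ y`. -/
def dominated (hS : IsFreeSkewExtension σ δ ι v) (J : Ideal S) (k : ℕ) : Set R :=
  {c | ∃ f ∈ J, f ∈ hS.degreeLE k ∧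
    ∀ b, (∀ w : FreeMonoid X, w.length = k → b * hS.coeff f w = 0) → b * c = 0}

variable {hS : IsFreeSkewExtension σ δ ι v} {J : Ideal S} {k : ℕ} {c d : R}

theorem mul_mem_topCoeffs (r : R) (hc : c ∈ hS.topCoeffs J k) : r * c ∈ hS.topCoeffs J k := by
  obtain ⟨f, hfJ, hf, w, hw, rfl⟩ := hc
  exact ⟨ι r * f, J.mul_mem_left _ hfJ, zero_add k ▸ mul_mem_degreeLE (ι_mem_degreeLE r) hf, w, hw,
    hS.coeff_ι_mul r f w⟩

theorem topCoeffs_mul_mem [J.IsTwoSided] (hσ : ∀ x, Function.Bijective (σ x))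
    (hc : c ∈ hS.topCoeffs J k) (r : R) : c * r ∈ hS.topCoeffs J k := by
  obtain ⟨f, hfJ, hf, w, hw, rfl⟩ := hc
  obtain ⟨r, rfl⟩ := (freeMonoid_lift_bijective hσ w).2 r
  refine ⟨f * ι r, J.mul_mem_right _ hfJ, mul_mem_degreeLE hf (ι_mem_degreeLE r), w, hw, ?_⟩
  have h := coeff_mul_of_mem_degreeLE hf (ι_mem_degreeLE r) hw FreeMonoid.length_one
  rwa [mul_one, coeff_ι, Finsupp.single_eq_same] at h

theorem apply_mem_topCoeffs (hc : c ∈ hS.topCoeffs J k) (x : X) :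
    σ x c ∈ hS.topCoeffs J (1 + k) := by
  obtain ⟨f, hfJ, hf, w, hw, rfl⟩ := hc
  refine ⟨v x * f, J.mul_mem_left _ hfJ, mul_mem_degreeLE (v_mem_degreeLE x) hf,
    FreeMonoid.of x * w, by rw [FreeMonoid.length_mul, FreeMonoid.length_of, hw], ?_⟩
  rw [coeff_mul_of_mem_degreeLE (v_mem_degreeLE x) hf (FreeMonoid.length_of x) hw, coeff_v,
    Finsupp.single_eq_same, one_mul, FreeMonoid.lift_eval_of]

theorem topCoeffs_mono [Nonempty X] [J.IsTwoSided] : Monotone (hS.topCoeffs J) := by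
  classical
  obtain ⟨x⟩ := ‹Nonempty X›
  refine monotone_nat_of_le_succ ?_
  rintro k _ ⟨f, hfJ, hf, w, hw, rfl⟩
  exact ⟨f * v x, J.mul_mem_right _ hfJ, mul_mem_degreeLE hf (v_mem_degreeLE x),
    w * FreeMonoid.of x, by rw [FreeMonoid.length_mul, FreeMonoid.length_of, hw],
    by rw [coeff_mul_v_of_mem_degreeLE hf hw, if_pos rfl]⟩

theorem add_mem_topCoeffs [Subsingleton X] (hc : c ∈ hS.topCoeffs J k)
    (hd : d ∈ hS.topCoeffs J k) : c + d ∈ hS.topCoeffs J k := by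
  obtain ⟨f, hfJ, hf, w, hw, rfl⟩ := hc
  obtain ⟨g, hgJ, hg, z, hz, rfl⟩ := hd
  obtain rfl : w = z := freeMonoid_eq_of_length_eq (hw.trans hz.symm)
  exact ⟨f + g, J.add_mem hfJ hgJ, add_mem hf hg, w, hw, by rw [map_add, Finsupp.add_apply]⟩

theorem topCoeffs_subset_dominated : hS.topCoeffs J k ⊆ hS.dominated J k := by
  rintro _ ⟨f, hfJ, hf, w, hw, rfl⟩
  exact ⟨f, hfJ, hf, fun b hb => hb w hw⟩

theorem mul_mem_dominated (r : R) (hc : c ∈ hS.dominated J k) : r * c ∈ hS.dominated J k := by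
  obtain ⟨f, hfJ, hf, hfc⟩ := hc
  refine ⟨ι r * f, J.mul_mem_left _ hfJ, zero_add k ▸ mul_mem_degreeLE (ι_mem_degreeLE r) hf,
    fun b hb => ?_⟩
  rw [← mul_assoc]
  refine hfc _ fun w hw => ?_
  rw [mul_assoc, ← hS.coeff_ι_mul]
  exact hb w hw

theorem dominated_mono [Nonempty X] [J.IsTwoSided] : Monotone (hS.dominated J) := by
  classical
  obtain ⟨x⟩ := ‹Nonempty X›
  refine monotone_nat_of_le_succ ?_
  rintro k c ⟨f, hfJ, hf, hfc⟩
  refine ⟨f * v x, J.mul_mem_right _ hfJ, mul_mem_degreeLE hf (v_mem_degreeLE x),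
    fun b hb => hfc b fun w hw => ?_⟩
  simpa only [coeff_mul_v_of_mem_degreeLE hf hw, if_true] using
    hb (w * FreeMonoid.of x) (by rw [FreeMonoid.length_mul, FreeMonoid.length_of, hw])

theorem add_mem_dominated [Nontrivial X] [J.IsTwoSided] (hc : c ∈ hS.dominated J k)
    (hd : d ∈ hS.dominated J k) : c + d ∈ hS.dominated J (k + 1) := by
  classical
  obtain ⟨f, hfJ, hf, hfc⟩ := hc
  obtain ⟨g, hgJ, hg, hgd⟩ := hd
  obtain ⟨x, y, hxy⟩ := exists_pair_ne X
  have hcoeff (w : FreeMonoid X) (hw : w.length = k) (t : X) :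
      hS.coeff (f * v x + g * v y) (w * FreeMonoid.of t) =
        (if x = t then hS.coeff f w else 0) + if y = t then hS.coeff g w else 0 := by
    rw [map_add, Finsupp.add_apply, coeff_mul_v_of_mem_degreeLE hf hw,
      coeff_mul_v_of_mem_degreeLE hg hw]
  refine ⟨f * v x + g * v y, J.add_mem (J.mul_mem_right _ hfJ) (J.mul_mem_right _ hgJ),
    add_mem (mul_mem_degreeLE hf (v_mem_degreeLE x)) (mul_mem_degreeLE hg (v_mem_degreeLE y)),
    fun b hb => ?_⟩
  have hb' (w : FreeMonoid X) (hw : w.length = k) (t : X) :=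
    hb (w * FreeMonoid.of t) (by rw [FreeMonoid.length_mul, FreeMonoid.length_of, hw])
  rw [mul_add, hfc b fun w hw => ?_, hgd b fun w hw => ?_, add_zero]
  · simpa only [hcoeff w hw, if_neg hxy, if_true, zero_add] using hb' w hw y
  · simpa only [hcoeff w hw, if_neg hxy.symm, if_true, add_zero] using hb' w hw x

theorem exists_mem_topCoeffs [Nonempty X] [Subsingleton X] [J.IsTwoSided]
    (hc : c ∈ hS.topCoeffIdeal J) : ∃ k, c ∈ hS.topCoeffs J k := by
  induction hc using Submodule.span_induction with
  | mem c hc => exact Set.mem_iUnion.1 hc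
  | zero => exact ⟨0, 0, J.zero_mem, zero_mem _, 1, FreeMonoid.length_one, by simp⟩
  | add c d _ _ hc hd =>
    obtain ⟨k, hc⟩ := hc
    obtain ⟨l, hd⟩ := hd
    exact ⟨max k l, add_mem_topCoeffs (topCoeffs_mono (le_max_left k l) hc)
      (topCoeffs_mono (le_max_right k l) hd)⟩
  | smul r c _ hc => exact hc.imp fun k => mul_mem_topCoeffs r

theorem exists_mem_dominated [Nonempty X] [J.IsTwoSided] (hc : c ∈ hS.topCoeffIdeal J) :
    ∃ k, c ∈ hS.dominated J k := by
  rcases subsingleton_or_nontrivial X with hX | hX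
  · exact (exists_mem_topCoeffs hc).imp fun k h => topCoeffs_subset_dominated h
  induction hc using Submodule.span_induction with
  | mem c hc => exact (Set.mem_iUnion.1 hc).imp fun k h => topCoeffs_subset_dominated h
  | zero => exact ⟨0, 0, J.zero_mem, zero_mem _, fun b _ => mul_zero b⟩
  | add c d _ _ hc hd =>
    obtain ⟨k, hc⟩ := hc
    obtain ⟨l, hd⟩ := hd
    exact ⟨max k l + 1, add_mem_dominated (dominated_mono (le_max_left k l) hc)
      (dominated_mono (le_max_right k l) hd)⟩
  | smul r c _ hc => exact hc.imp fun k => mul_mem_dominated r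

theorem topCoeffIdeal_isTwoSided [J.IsTwoSided] (hσ : ∀ x, Function.Bijective (σ x)) :
    (hS.topCoeffIdeal J).IsTwoSided where
  mul_mem_of_left {c} r hc := by
    induction hc using Submodule.span_induction with
    | mem c hc =>
      obtain ⟨k, hc⟩ := Set.mem_iUnion.1 hc
      exact Ideal.subset_span (Set.mem_iUnion.2 ⟨k, topCoeffs_mul_mem hσ hc r⟩)
    | zero => rw [zero_mul]; exact zero_mem _
    | add c d _ _ hc hd => rw [add_mul]; exact add_mem hc hd
    | smul s c _ hc => rw [smul_mul_assoc]; exact Submodule.smul_mem _ s hc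

theorem topCoeffIdeal_le_comap (x : X) :
    hS.topCoeffIdeal J ≤ (hS.topCoeffIdeal J).comap (σ x) := by
  refine Ideal.span_le.2 (Set.iUnion_subset fun k c hc => ?_)
  exact Ideal.subset_span (Set.mem_iUnion.2 ⟨1 + k, apply_mem_topCoeffs hc x⟩)

theorem topCoeffIdeal_ne_bot (hJ : J ≠ ⊥) : hS.topCoeffIdeal J ≠ ⊥ := by
  obtain ⟨f, hfJ, hf⟩ := Submodule.exists_mem_ne_zero_of_ne_bot hJ
  obtain ⟨w, hw, hfw⟩ := hS.exists_mem_degreeLE_coeff_ne_zero hf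
  have hmem : hS.coeff f w ∈ hS.topCoeffIdeal J :=
    Ideal.subset_span (Set.mem_iUnion.2 ⟨w.length, f, hfJ, hw, w, rfl, rfl⟩)
  exact Submodule.ne_bot_iff _ |>.2 ⟨_, hmem, hfw⟩

end TopCoefficients

section Goldie

variable {hS : IsFreeSkewExtension σ δ ι v}

theorem exists_top_regular_mod_leftAnnihilator [Nonempty X] (hG : IsLeftGoldie R)
    (hR : IsSemiprimeIdeal (⊥ : Ideal R)) (hσ : ∀ x, Function.Bijective (σ x)) (J : Ideal S)
    [J.IsTwoSided] :
    ∃ k > 0, ∃ g ∈ J, g ∈ hS.degreeLE k ∧ ∀ b, (∀ w : FreeMonoid X, w.length = k →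
      b * hS.coeff g w ∈ leftAnnihilator (hS.topCoeffIdeal J : Set R)) →
        b ∈ leftAnnihilator (hS.topCoeffIdeal J : Set R) := by
  set I := hS.topCoeffIdeal J
  have : I.IsTwoSided := topCoeffIdeal_isTwoSided hσ
  obtain ⟨c, hcI, hc⟩ := hG.exists_mem_inf_leftAnnihilator_eq_bot hR I
  obtain ⟨k, hk⟩ := exists_mem_dominated hcI
  obtain ⟨f, hfJ, hf, hfc⟩ := dominated_mono k.le_succ hk
  refine ⟨k + 1, k.succ_pos, ι c * f, J.mul_mem_left _ hfJ,
    zero_add (k + 1) ▸ mul_mem_degreeLE (ι_mem_degreeLE c) hf, fun b hb => ?_⟩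
  have hbcf (w : FreeMonoid X) (hw : w.length = k + 1) : b * c * hS.coeff f w = 0 := by
    have hQ := hb w hw
    rw [coeff_ι_mul, ← mul_assoc] at hQ
    have hI : b * c * hS.coeff f w ∈ I := I.mul_mem_right _ (I.mul_mem_left b hcI)
    rw [← Ideal.mem_bot, ← inf_leftAnnihilator_eq_bot hR (I := I)]
    exact ⟨hI, hQ⟩
  have hbc : b * c = 0 := by
    rw [← Ideal.mem_bot, ← hc]
    exact ⟨I.mul_mem_left b hcI, mem_leftAnnihilator_singleton.2 (hfc _ hbcf)⟩
  exact leftAnnihilator_singleton_le hR hc (mem_leftAnnihilator_singleton.2 hbc)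

theorem mul_one_add_ne_one [Nontrivial R] (hσ : ∀ x, Function.Bijective (σ x)) {k : ℕ}
    (hk : 0 < k) {g : S} (hg : g ∈ hS.degreeLE k)
    (hreg : ∀ b, (∀ w : FreeMonoid X, w.length = k → b * hS.coeff g w = 0) → b = 0) (z : S) :
    z * (1 + g) ≠ 1 := by
  classical
  intro hz
  have hz0 : z ≠ 0 := by
    rintro rfl
    have h := congrArg (fun s => hS.coeff s 1) hz
    simp only [zero_mul, map_zero, coeff_one, Finsupp.zero_apply, Finsupp.single_eq_same] at h
    exact zero_ne_one h
  obtain ⟨u, hu, hzu⟩ := hS.exists_mem_degreeLE_coeff_ne_zero hz0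
  obtain ⟨b, hb⟩ := (freeMonoid_lift_bijective hσ u).2 (hS.coeff z u)
  have hb0 : b = 0 := hreg b fun w hw => by
    have hlen : u.length < (u * w).length := by rw [FreeMonoid.length_mul]; lia
    have h1 : u * w ≠ 1 := by
      intro h
      rw [h, FreeMonoid.length_one] at hlen
      exact not_lt_zero hlen
    have htop := congrArg (fun s => hS.coeff s (u * w)) hz
    simp only [mul_add, mul_one, map_add, Finsupp.add_apply, hu _ hlen, zero_add, coeff_one,
      Finsupp.single_eq_of_ne h1] at htop
    rw [coeff_mul_of_mem_degreeLE hu hg rfl hw, ← hb, ← map_mul] at htop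
    exact (map_eq_zero_iff _ (freeMonoid_lift_bijective hσ u).1).1 htop
  exact hzu (by rw [← hb, hb0, map_zero])

theorem jacobson_eq_bot [Nonempty X] (hS : IsFreeSkewExtension σ δ ι v) (hG : IsLeftGoldie R)
    (hR : IsSemiprimeIdeal (⊥ : Ideal R)) (hσ : ∀ x, Function.Bijective (σ x))
    (hδ : ∀ x, IsSkewDerivation (σ x) (δ x)) : Ring.jacobson S = ⊥ := by
  by_contra hJ
  have := hG.leftAnnihilatorACC
  set I := hS.topCoeffIdeal (Ring.jacobson S)
  set Q := leftAnnihilator (I : Set R)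
  have : I.IsTwoSided := topCoeffIdeal_isTwoSided hσ
  have hQσ' (x : X) : Q.comap (σ x) ≤ Q :=
    comap_leftAnnihilator_le (hσ x).1 (topCoeffIdeal_le_comap x)
  have hQσ (x : X) : Q ≤ Q.comap (σ x) := le_comap_leftAnnihilator (hσ x) (hQσ' x)
  have hQ : Q ≠ ⊤ := fun h => topCoeffIdeal_ne_bot hJ (by
    rw [← inf_leftAnnihilator_eq_bot hR (I := I)]
    exact (inf_eq_left.2 (le_top.trans_eq h.symm)).symm)
  have := Ideal.Quotient.nontrivial_iff.2 hQ
  obtain ⟨S', _, ι', v', hS', φ, -, hφ⟩ :=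
    hS.exists_quotient hδ hQσ fun x a => (hδ x).apply_mem_leftAnnihilator hR (hQσ x)
  obtain ⟨k, hk, g, hgJ, hg, hreg⟩ :=
    exists_top_regular_mod_leftAnnihilator (hS := hS) hG hR hσ (Ring.jacobson S)
  obtain ⟨z, hz⟩ : ∃ z, z * (1 + g) = 1 := by
    rw [← Ideal.jacobson_bot, Ideal.mem_jacobson_iff] at hgJ
    obtain ⟨z, hz⟩ := hgJ 1
    exact ⟨z, by rw [mul_add, add_comm]; simpa [sub_eq_zero] using hz⟩
  refine mul_one_add_ne_one (hS := hS') (fun x => ⟨Ideal.quotientMap_injective' (hQσ' x),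
    Ideal.quotientMap_surjective (hσ x).2⟩) hk (g := φ g) (fun w hw => ?_) (fun b hb => ?_) (φ z) ?_
  · rw [hφ, hg w hw, map_zero]
  · obtain ⟨b, rfl⟩ := Ideal.Quotient.mk_surjective b
    refine Ideal.Quotient.eq_zero_iff_mem.2 (hreg b fun w hw => ?_)
    rw [← Ideal.Quotient.eq_zero_iff_mem, map_mul, ← hφ]
    exact hb w hw
  · rw [← map_one φ, ← map_add, ← map_mul, hz, map_one]

end Goldie

end IsFreeSkewExtension

end Jacobson

section IdealPowers

variable {R : Type*} [Ring R] {σ : R →+* R} {δ : R →+ R} {P : Ideal R} [P.IsTwoSided]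

theorem pow_le_comap_pow {R' : Type*} [Ring R'] {Q : Ideal R'} [Q.IsTwoSided] {f : R →+* R'}
    (h : P ≤ Q.comap f) (k : ℕ) : P ^ k ≤ (Q ^ k).comap f := by
  induction k with
  | zero => simp only [Submodule.pow_zero, Ideal.one_eq_top, Ideal.comap_top, le_refl]
  | succ k ih =>
    rw [Ideal.IsTwoSided.pow_succ, Ideal.IsTwoSided.pow_succ, Ideal.mul_le]
    intro a ha b hb
    rw [Ideal.mem_comap, map_mul]
    exact Ideal.mul_mem_mul (h ha) (ih hb)

namespace IsSkewDerivation

theorem apply_mem_pow (hδ : IsSkewDerivation σ δ) (hσP : P ≤ P.comap σ) {k : ℕ} {a : R}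
    (ha : a ∈ P ^ (k + 1)) : δ a ∈ P ^ k := by
  induction k generalizing a with
  | zero => simp only [Submodule.pow_zero, Ideal.one_eq_top, Submodule.mem_top]
  | succ k ih =>
    rw [Ideal.IsTwoSided.pow_succ] at ha
    induction ha using Submodule.mul_induction_on' with
    | mem_mul_mem a ha b hb =>
      rw [hδ]
      refine add_mem (Ideal.mul_mem_left _ _ hb) ?_
      rw [Ideal.IsTwoSided.pow_succ]
      exact Ideal.mul_mem_mul (hσP ha) (ih hb)
    | add a _ b _ ha hb => rw [map_add]; exact add_mem ha hb

theorem iterate_apply_mem_pow (hδ : IsSkewDerivation σ δ) (hσP : P ≤ P.comap σ) {k l : ℕ} {a : R}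
    (ha : a ∈ P ^ (k + l)) : δ^[l] a ∈ P ^ k := by
  induction l generalizing a with
  | zero => exact ha
  | succ l ih => exact ih (hδ.apply_mem_pow hσP ha)

theorem iterate_apply_mem (hδ : IsSkewDerivation σ δ) (hσP : P ≤ P.comap σ) {k l : ℕ} (hl : l < k)
    {a : R} (ha : a ∈ P ^ k) : δ^[l] a ∈ P := by
  rw [← P.pow_one]
  exact hδ.iterate_apply_mem_pow hσP (Ideal.pow_le_pow_right (by lia) ha)

theorem apply_mem_pow_of_stable (hδ : IsSkewDerivation σ δ) (hσP : P ≤ P.comap σ)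
    (hδP : ∀ a ∈ P, δ a ∈ P) {k : ℕ} {a : R} (ha : a ∈ P ^ k) : δ a ∈ P ^ k := by
  induction k generalizing a with
  | zero => simp only [Submodule.pow_zero, Ideal.one_eq_top, Submodule.mem_top]
  | succ k ih =>
    rw [Ideal.IsTwoSided.pow_succ] at ha ⊢
    induction ha using Submodule.mul_induction_on' with
    | mem_mul_mem a ha b hb =>
      rw [hδ]
      exact add_mem (Ideal.mul_mem_mul (hδP a ha) hb) (Ideal.mul_mem_mul (hσP ha) (ih hb))
    | add a _ b _ ha hb => rw [map_add]; exact add_mem ha hb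

end IsSkewDerivation

end IdealPowers

section QLeibniz

namespace IsSkewDerivation

variable {K R : Type*} [CommSemiring K] [Ring R] [Algebra K R] {σ : R →ₐ[K] R} {δ : R →+ R} {q : K}

theorem apply_iterate (hqδ : ∀ r, δ (σ r) = q • σ (δ r)) (i : ℕ) (a : R) :
    δ (σ^[i] a) = q ^ i • σ^[i] (δ a) := by
  induction i with
  | zero => simp only [Function.iterate_zero, id_eq, pow_zero, one_smul]
  | succ i ih =>
    rw [Function.iterate_succ_apply', hqδ, ih, map_smul, smul_smul, ← pow_succ',
      Function.iterate_succ_apply']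

theorem apply_mem_span_iterate (hδ : IsSkewDerivation (σ : R →+* R) δ) {b e : R} {i : ℕ}
    (he : e ∈ Ideal.span ((fun l => δ^[l] b) '' Set.Iio i)) :
    δ e ∈ Ideal.span ((fun l => δ^[l] b) '' Set.Iio (i + 1)) := by
  have hgen (l : ℕ) (hl : l < i + 1) :
      δ^[l] b ∈ Ideal.span ((fun l => δ^[l] b) '' Set.Iio (i + 1)) :=
    Ideal.subset_span ⟨l, hl, rfl⟩
  induction he using Submodule.closure_induction with
  | zero => rw [map_zero]; exact zero_mem _
  | add x y _ _ hx hy => rw [map_add]; exact add_mem hx hy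
  | smul_mem r x hx =>
    obtain ⟨l, hl, rfl⟩ := hx
    rw [Set.mem_Iio] at hl
    rw [smul_eq_mul, hδ]
    dsimp only
    rw [← Function.iterate_succ_apply' δ]
    exact add_mem (Ideal.mul_mem_left _ _ (hgen l (by lia)))
      (Ideal.mul_mem_left _ _ (hgen (l + 1) (by lia)))

theorem iterate_mul_sub_mem (hδ : IsSkewDerivation (σ : R →+* R) δ)
    (hqδ : ∀ r, δ (σ r) = q • σ (δ r)) (a b : R) (i : ℕ) :
    δ^[i + 1] (a * b) - (σ^[i + 1] a * δ^[i + 1] b +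
        (∑ j ∈ Finset.range (i + 1), q ^ j) • (σ^[i] (δ a) * δ^[i] b)) ∈
      Ideal.span ((fun l => δ^[l] b) '' Set.Iio i) := by
  have hδ' (a b : R) : δ (a * b) = δ a * b + σ a * δ b := hδ a b
  induction i with
  | zero =>
    have hzero : δ^[0 + 1] (a * b) - (σ^[0 + 1] a * δ^[0 + 1] b +
        (∑ j ∈ Finset.range (0 + 1), q ^ j) • (σ^[0] (δ a) * δ^[0] b)) = 0 := by
      simp [hδ', add_comm]
    rw [hzero]
    exact zero_mem _
  | succ i ih =>
    set c := ∑ j ∈ Finset.range (i + 1), q ^ j with hc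
    have htop : δ (σ^[i + 1] a * δ^[i + 1] b) =
        q ^ (i + 1) • (σ^[i + 1] (δ a) * δ^[i + 1] b) + σ^[i + 2] a * δ^[i + 2] b := by
      rw [hδ', apply_iterate hqδ, smul_mul_assoc, ← Function.iterate_succ_apply' σ,
        ← Function.iterate_succ_apply' δ]
    have hmid : δ (c • (σ^[i] (δ a) * δ^[i] b)) =
        δ (c • σ^[i] (δ a)) * δ^[i] b + c • (σ^[i + 1] (δ a) * δ^[i + 1] b) := by
      rw [← smul_mul_assoc, hδ', map_smul σ, smul_mul_assoc, ← Function.iterate_succ_apply' σ,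
        ← Function.iterate_succ_apply' δ]
    have hlow : δ (c • σ^[i] (δ a)) * δ^[i] b ∈
        Ideal.span ((fun l => δ^[l] b) '' Set.Iio (i + 1)) :=
      Ideal.mul_mem_left _ _ (Ideal.subset_span ⟨i, i.lt_succ_self, rfl⟩)
    convert add_mem (hδ.apply_mem_span_iterate ih) hlow using 1
    rw [map_sub, map_add, htop, hmid, Function.iterate_succ_apply' δ (i + 1),
      Finset.sum_range_succ _ (i + 1), ← hc, add_smul]
    abel

section Stability

variable {P : Ideal R} [P.IsTwoSided]

theorem iterate_mul_sub_mem_of_mem_pow (hδ : IsSkewDerivation (σ : R →+* R) δ)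
    (hqδ : ∀ r, δ (σ r) = q • σ (δ r)) (hσP : P ≤ P.comap (σ : R →+* R)) (a : R) {b : R} {i : ℕ}
    (hb : b ∈ P ^ i) :
    δ^[i + 1] (a * b) - (σ^[i + 1] a * δ^[i + 1] b +
      (∑ j ∈ Finset.range (i + 1), q ^ j) • (σ^[i] (δ a) * δ^[i] b)) ∈ P := by
  refine Ideal.span_le.2 ?_ (hδ.iterate_mul_sub_mem hqδ a b i)
  rintro _ ⟨l, hl, rfl⟩
  exact hδ.iterate_apply_mem hσP hl hb

theorem apply_mul_iterate_mem (hδ : IsSkewDerivation (σ : R →+* R) δ)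
    (hqδ : ∀ r, δ (σ r) = q • σ (δ r)) (hσ : Function.Surjective σ)
    (hσP : P.comap (σ : R →+* R) = P) {k : ℕ}
    (htors : ∀ a : R, (∑ j ∈ Finset.range (k + 1), q ^ j) • a ∈ P → a ∈ P)
    (hk : ∀ a ∈ P ^ (k + 1), δ^[k + 1] a ∈ P) {p b : R} (hp : p ∈ P) (hb : b ∈ P ^ k) :
    δ p * δ^[k] b ∈ P := by
  have hσi (i : ℕ) (a : R) : σ^[i] a ∈ P ↔ a ∈ P := by
    induction i generalizing a with
    | zero => exact Iff.rfl
    | succ i ih => exact (ih (σ a)).trans (Ideal.ext_iff.1 hσP a)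
  obtain ⟨a, rfl⟩ := hσ.iterate k p
  have ha : a ∈ P := (hσi k a).1 hp
  have hab : δ^[k + 1] (a * b) ∈ P :=
    hk _ (by rw [Ideal.IsTwoSided.pow_succ]; exact Ideal.mul_mem_mul ha hb)
  have hsum := (P.sub_mem_iff_right hab).1
    (hδ.iterate_mul_sub_mem_of_mem_pow hqδ hσP.ge a hb)
  have hmid := htors _ <|
    (P.add_mem_iff_right (P.mul_mem_right (δ^[k + 1] b) ((hσi (k + 1) a).2 ha))).1 hsum
  rw [apply_iterate hqδ, smul_mul_assoc]
  exact P.smul_of_tower_mem _ hmid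

theorem iterate_mem_of_iterate_succ_mem (hδ : IsSkewDerivation (σ : R →+* R) δ)
    (hqδ : ∀ r, δ (σ r) = q • σ (δ r)) (hP : IsSemiprimeIdeal P) (hσ : Function.Surjective σ)
    (hσP : P.comap (σ : R →+* R) = P) {k : ℕ}
    (htors : ∀ a : R, (∑ j ∈ Finset.range (k + 2), q ^ j) • a ∈ P → a ∈ P)
    (hk : ∀ a ∈ P ^ (k + 2), δ^[k + 2] a ∈ P) {b : R} (hb : b ∈ P ^ (k + 1)) :
    δ^[k + 1] b ∈ P := by
  refine hP _ fun r => ?_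
  obtain ⟨r, rfl⟩ := hσ.iterate (k + 1) r
  have hp : δ^[k] b ∈ P := hδ.iterate_apply_mem hσP.ge k.lt_succ_self hb
  have hprod : δ^[k + 1] b * δ^[k + 1] (r * b) ∈ P := by
    rw [Function.iterate_succ_apply' δ k b]
    exact hδ.apply_mul_iterate_mem hqδ hσ hσP htors hk hp (Ideal.mul_mem_left _ r hb)
  have hsum := P.mul_mem_left (δ^[k + 1] b) <|
    hδ.iterate_mul_sub_mem_of_mem_pow hqδ hσP.ge r (Ideal.pow_le_pow_right k.le_succ hb)
  rw [mul_sub, P.sub_mem_iff_right hprod, mul_add, ← mul_assoc] at hsum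
  exact (P.add_mem_iff_left (P.mul_mem_left _ (P.smul_of_tower_mem _ (P.mul_mem_left _ hp)))).1 hsum

theorem apply_mem_of_pow_eq_bot (hδ : IsSkewDerivation (σ : R →+* R) δ)
    (hqδ : ∀ r, δ (σ r) = q • σ (δ r)) (hP : IsSemiprimeIdeal P) (hσ : Function.Surjective σ)
    (hσP : P.comap (σ : R →+* R) = P) {n : ℕ} (hn : P ^ n = ⊥)
    (htors : ∀ k < n, ∀ a : R, (∑ j ∈ Finset.range (k + 1), q ^ j) • a ∈ P → a ∈ P) {a : R}
    (ha : a ∈ P) : δ a ∈ P := by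
  have hbot : ∀ b ∈ P ^ max n 1, δ^[max n 1] b ∈ P := by
    intro b hb
    have hb0 : b ∈ P ^ n := Ideal.pow_le_pow_right (le_max_left n 1) hb
    rw [hn, Submodule.mem_bot] at hb0
    rw [hb0, iterate_map_zero]
    exact zero_mem P
  have hone : ∀ b ∈ P ^ 1, δ^[1] b ∈ P := by
    refine Nat.decreasingInduction' (P := fun k => ∀ b ∈ P ^ k, δ^[k] b ∈ P)
      (fun k hkn hk ih b hb => ?_) (le_max_right n 1) hbot
    obtain ⟨k, rfl⟩ := Nat.exists_eq_add_of_le' hk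
    exact hδ.iterate_mem_of_iterate_succ_mem hqδ hP hσ hσP (htors (k + 1) (by lia)) ih hb
  exact hone a (P.pow_one.symm ▸ ha)

end Stability

end IsSkewDerivation

end QLeibniz

section PrimeRadical

variable {R R' : Type*} [Ring R] [Ring R']

theorem IsTwoSidedPrime.comap {P : Ideal R'} (hP : IsTwoSidedPrime P) {f : R →+* R'}
    (hf : Function.Surjective f) : IsTwoSidedPrime (P.comap f) := by
  have := hP.isTwoSided
  refine ⟨inferInstance, Ideal.comap_ne_top f hP.ne_top, fun a b hab => ?_⟩
  refine hP.mem_or_mem (f a) (f b) fun r => ?_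
  obtain ⟨r, rfl⟩ := hf r
  simpa only [Ideal.mem_comap, map_mul] using hab r

theorem primeRadical_le_comap {f : R →+* R'} (hf : Function.Surjective f) :
    primeRadical R ≤ (primeRadical R').comap f := fun _ ha =>
  Submodule.mem_sInf.2 fun P hP => Submodule.mem_sInf.1 ha (Ideal.comap f P) (hP.comap hf)

theorem comap_primeRadical (e : R ≃+* R') :
    (primeRadical R').comap (e : R →+* R') = primeRadical R := by
  refine le_antisymm (fun a ha => ?_) (primeRadical_le_comap e.surjective)
  simpa using primeRadical_le_comap (f := (e.symm : R' →+* R)) e.symm.surjective ha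

end PrimeRadical

section Nilpotence

variable {R X S : Type*} [Ring R] [Ring S] {σ : X → R →+* R} {δ : X → R →+ R} {ι : R →+* S}
  {v : X → S}

namespace IsFreeSkewExtension

theorem coeff_v_mul_mem (hS : IsFreeSkewExtension σ δ ι v) {I : Ideal R} {x : X}
    (hσI : I ≤ I.comap (σ x)) (hδI : ∀ a ∈ I, δ x a ∈ I) {s : S} (hs : ∀ w, hS.coeff s w ∈ I)
    (w : FreeMonoid X) : hS.coeff (v x * s) w ∈ I := by
  classical
  induction w using FreeMonoid.casesOn with
  | one => rw [coeff_v_mul_one]; exact hδI _ (hs 1)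
  | of_mul y w =>
    rw [coeff_v_mul_of_mul]
    refine add_mem ?_ (hδI _ (hs _))
    split_ifs
    exacts [hσI (hs w), zero_mem I]

theorem coeff_word_mul_mem (hS : IsFreeSkewExtension σ δ ι v) {I : Ideal R}
    (hσI : ∀ x, I ≤ I.comap (σ x)) (hδI : ∀ x, ∀ a ∈ I, δ x a ∈ I) {s : S}
    (hs : ∀ w, hS.coeff s w ∈ I) (u w : FreeMonoid X) :
    hS.coeff (FreeMonoid.lift v u * s) w ∈ I := by
  induction u using FreeMonoid.inductionOn' generalizing w with
  | one => simpa only [map_one, one_mul] using hs w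
  | of_mul x u ih =>
    rw [map_mul (FreeMonoid.lift v), FreeMonoid.lift_eval_of, mul_assoc]
    exact hS.coeff_v_mul_mem (hσI x) (hδI x) ih w

variable {P : Ideal R} [P.IsTwoSided]

theorem coeff_mem_pow_of_mem_pow (hS : IsFreeSkewExtension σ δ ι v)
    (hδ : ∀ x, IsSkewDerivation (σ x) (δ x)) (hσP : ∀ x, P ≤ P.comap (σ x))
    (hδP : ∀ x, ∀ a ∈ P, δ x a ∈ P) {J : Ideal S} [J.IsTwoSided]
    (hJ : ∀ s ∈ J, ∀ w, hS.coeff s w ∈ P) {k : ℕ} {s : S} (hs : s ∈ J ^ k) (w : FreeMonoid X) :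
    hS.coeff s w ∈ P ^ k := by
  induction k generalizing s w with
  | zero => simp only [Submodule.pow_zero, Ideal.one_eq_top, Submodule.mem_top]
  | succ k ih =>
    rw [Ideal.IsTwoSided.pow_succ] at hs ⊢
    induction hs using Submodule.mul_induction_on' with
    | mem_mul_mem g hg f hf =>
      refine hS.coeff_mul_mem fun u => Ideal.mul_mem_mul (hJ g hg u) ?_
      exact hS.coeff_word_mul_mem (fun x => pow_le_comap_pow (hσP x) k)
        (fun x a ha => (hδ x).apply_mem_pow_of_stable (hσP x) (hδP x) ha) (ih hf) u w
    | add g _ f _ hg hf => rw [map_add]; exact add_mem hg hf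

theorem pow_eq_bot_of_coeff_mem (hS : IsFreeSkewExtension σ δ ι v)
    (hδ : ∀ x, IsSkewDerivation (σ x) (δ x)) (hσP : ∀ x, P ≤ P.comap (σ x))
    (hδP : ∀ x, ∀ a ∈ P, δ x a ∈ P) {J : Ideal S} [J.IsTwoSided]
    (hJ : ∀ s ∈ J, ∀ w, hS.coeff s w ∈ P) {n : ℕ} (hn : P ^ n = ⊥) : J ^ n = ⊥ := by
  refine (Submodule.eq_bot_iff _).2 fun s hs => hS.coeff_injective (Finsupp.ext fun w => ?_)
  have hsw := hS.coeff_mem_pow_of_mem_pow hδ hσP hδP hJ hs w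
  rw [hn, Submodule.mem_bot] at hsw
  rw [hsw, map_zero, Finsupp.zero_apply]

theorem coeff_mem_of_mem_jacobson [Nonempty X] (hS : IsFreeSkewExtension σ δ ι v)
    (hδ : ∀ x, IsSkewDerivation (σ x) (δ x)) (hσ : ∀ x, Function.Surjective (σ x))
    (hσP : ∀ x, P.comap (σ x) = P) (hδP : ∀ x, ∀ a ∈ P, δ x a ∈ P) (hP : IsSemiprimeIdeal P)
    (hG : IsLeftGoldie (R ⧸ P)) {s : S} (hs : s ∈ Ring.jacobson S) (w : FreeMonoid X) :
    hS.coeff s w ∈ P := by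
  obtain ⟨S', _, ι', v', hS', φ, hφsurj, hφ⟩ := hS.exists_quotient hδ (fun x => (hσP x).ge) hδP
  have : RingHomSurjective φ := ⟨hφsurj⟩
  have hφs : φ s ∈ Ring.jacobson S' := Ring.le_comap_jacobson φ hs
  rw [hS'.jacobson_eq_bot hG hP.bot_quotient
    (fun x => ⟨Ideal.quotientMap_injective' (hσP x).le, Ideal.quotientMap_surjective (hσ x)⟩)
    (fun x => (hδ x).quotient (hσP x).ge (hδP x)), Submodule.mem_bot] at hφs
  rw [← Ideal.Quotient.eq_zero_iff_mem, ← hφ, hφs, map_zero, Finsupp.zero_apply]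

end IsFreeSkewExtension

end Nilpotence

theorem sum_range_pow_ne_zero_of_qFactorial_ne_zero {F : Type*} [Field F] {q : F} {n k : ℕ}
    (h : qFactorial q n ≠ 0) (hk : k < n) : ∑ j ∈ Finset.range (k + 1), q ^ j ≠ 0 :=
  Finset.prod_ne_zero_iff.1 h (k + 1) (Finset.mem_Icc.2 ⟨k.succ_pos, hk⟩)

theorem mainTheorem4_general {K R X S : Type*} [CommSemiring K] [Ring R] [Algebra K R] [Nonempty X]
    [Ring S] (σ : X → R ≃ₐ[K] R) (δ : X → R →+ R)
    (hδ : ∀ x, IsSkewDerivation ((σ x : R ≃+* R) : R →+* R) (δ x))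
    (n : ℕ) (hn : primeRadical R ^ n = ⊥) (hGoldie : IsLeftGoldie (R ⧸ primeRadical R)) (q : X → K)
    (hqδ : ∀ x r, δ x (σ x r) = q x • σ x (δ x r))
    (htors : ∀ x, ∀ k < n, ∀ a : R,
      (∑ j ∈ Finset.range (k + 1), q x ^ j) • a ∈ primeRadical R → a ∈ primeRadical R)
    (ι : R →+* S) (v : X → S)
    (hS : IsFreeSkewExtension (fun x => ((σ x : R ≃+* R) : R →+* R)) δ ι v) :
    Ring.jacobson S ^ n = ⊥ := by
  have hσP (x : X) : (primeRadical R).comap ((σ x : R ≃+* R) : R →+* R) = primeRadical R :=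
    comap_primeRadical (σ x : R ≃+* R)
  have hδP (x : X) : ∀ a ∈ primeRadical R, δ x a ∈ primeRadical R := fun a ha =>
    IsSkewDerivation.apply_mem_of_pow_eq_bot (σ := (σ x : R →ₐ[K] R)) (hδ x) (hqδ x)
      isSemiprimeIdeal_primeRadical (σ x).surjective (hσP x) hn (htors x) ha
  have hcoeff : ∀ s ∈ Ring.jacobson S, ∀ w, hS.coeff s w ∈ primeRadical R := fun s hs =>
    hS.coeff_mem_of_mem_jacobson hδ (fun x => (σ x).surjective) hσP hδP
      isSemiprimeIdeal_primeRadical hGoldie hs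
  exact hS.pow_eq_bot_of_coeff_mem hδ (fun x => (hσP x).ge) hδP hcoeff hn

theorem mainTheorem4 {F R X S : Type*} [Field F] [Ring R] [Algebra F R] [Nonempty X] [Ring S]
    (σ : X → R ≃ₐ[F] R) (δ : X → R →+ R)
    (hδ : ∀ x, IsSkewDerivation ((σ x : R ≃+* R) : R →+* R) (δ x))
    (n : ℕ) (hnil : IsNilpotent (primeRadical R)) (hn : nilpotencyClass (primeRadical R) = n)
    (hGoldie : IsLeftGoldie (R ⧸ primeRadical R))
    (q : X → F) (hq : ∀ x, q x ≠ 0)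
    (hqδ : ∀ x r, δ x (σ x r) = q x • σ x (δ x r))
    (hfact : ∀ x, qFactorial (q x) n ≠ 0)
    (ι : R →+* S) (v : X → S)
    (hS : IsFreeSkewExtension (fun x => ((σ x : R ≃+* R) : R →+* R)) δ ι v) :
    IsNilpotent (Ring.jacobson S) := by
  have hpow : primeRadical R ^ n = ⊥ := hn ▸ pow_nilpotencyClass hnil
  exact ⟨n, mainTheorem4_general σ δ hδ n hpow hGoldie q hqδ (fun x k hk _ =>
    (Submodule.smul_mem_iff _ (sum_range_pow_ne_zero_of_qFactorial_ne_zero (hfact x) hk)).1) ι v hS⟩
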